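/- **Theorem 1.3.** All graphs are finite and simple. For a graph $G$ let $A(G)$ be its adjacency matrix, $D(G)$ the diagonal matrix of its vertex degrees, and for $0\le\alpha\le 1$ let $\lambda_\alpha(G)$ be the largest eigenvalue of the real symmetric matrix $A_\alpha(G)=\alpha D(G)+(1-\alpha)A(G)$. The dissociation number of $G$ is the largest cardinality of a set $S$ of vertices such that every vertex of the induced subgraph $G[S]$ has degree at most one in $G[S]$. Let $S_m$ be the star on $m$ vertices (for $m=1$ a single vertex, which is its centre, without leaves; for $m=2$ one of the two vertices is taken as the centre and the other as the leaf). Let $S^\dagger_{n,\tau}$ be the graph obtained from $S_{n-\tau}$ by attaching exactly two pendant edges to each leaf of $S_{n-\tau}$ and $3\tau-2n+2$ pendant edges to its centre. Let $n\ge 3$, let $T$ be a tree on $n$ vertices with dissociation number $\tau$, and let $0\le\alpha<1$. Then the polynomial $$\begin{aligned}P_\alpha(x)={}&x^4+\alpha(n-2\tau-6)x^3+(8\alpha^2\tau-4\alpha^2n+4\alpha\tau-2\alpha n-2\tau+n+9\alpha^2+6\alpha-3)x^2\\&+\alpha(16\alpha n-\alpha^2n-8n-28\alpha\tau+14\tau-20\alpha+10)x+2\alpha^3n-17\alpha^2n+16\alpha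 n-4n\\&+24\alpha^2\tau-24\alpha\tau+6\tau-2\alpha^3+17\alpha^2-16\alpha+4\end{aligned}$$ has a largest real zero $\theta(\alpha,n,\tau)$, and $$\lambda_\alpha(T)\le\theta(\alpha,n,\tau).$$ If $n\ge 4$ or $\alpha=0$, then equality holds if and only if $T\cong S^\dagger_{n,\tau}$. Moreover, $S^\dagger_{n,\tau}$ is itself a tree on $n$ vertices with dissociation number $\tau$, and $\lambda_\alpha(T)\le\lambda_\alpha(S^\dagger_{n,\tau})$, with equality if and only if $T\cong S^\dagger_{n,\tau}$. -/

import Mathlib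

namespace SimpleGraph

/-- `S` is a dissociation set of `G`: no vertex of `S` has two distinct neighbours in `S`, i.e.
every vertex of the induced subgraph `G[S]` has degree at most one. -/
def IsDissociationSet {V : Type*} (G : SimpleGraph V) (S : Finset V) : Prop :=
  ∀ v ∈ S, ∀ u ∈ S, ∀ w ∈ S, G.Adj v u → G.Adj v w → u = w

/-- The dissociation number of a finite graph: the largest cardinality of a dissociation set. -/
noncomputable def dissociationNumber {V : Type*} [Fintype V] (G : SimpleGraph V) : ℕ :=
  sSup {k : ℕ | ∃ S : Finset V, G.IsDissociationSet S ∧ S.card = k}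

/-- The supremum in the definition of the dissociation number is a maximum. -/
theorem isGreatest_dissociationNumber {V : Type*} [Fintype V] (G : SimpleGraph V) :
    IsGreatest {k : ℕ | ∃ S : Finset V, G.IsDissociationSet S ∧ S.card = k}
      G.dissociationNumber := by
  have hne : {k : ℕ | ∃ S : Finset V, G.IsDissociationSet S ∧ S.card = k}.Nonempty :=
    ⟨0, ∅, by simp [IsDissociationSet], rfl⟩
  have hbd : BddAbove {k : ℕ | ∃ S : Finset V, G.IsDissociationSet S ∧ S.card = k} := by
    refine ⟨Fintype.card V, ?_⟩
    rintro k ⟨S, -, rfl⟩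
    exact S.card_le_univ
  exact ⟨Nat.sSup_mem hne hbd, fun k hk => le_csSup hbd hk⟩

open Classical in
/-- The matrix `A_α(G) = α D(G) + (1 - α) A(G)`. -/
noncomputable def alphaMatrix {V : Type*} [Fintype V] (α : ℝ) (G : SimpleGraph V) :
    Matrix V V ℝ :=
  α • G.degMatrix ℝ + (1 - α) • G.adjMatrix ℝ

open Classical in
/-- The `A_α`-index of `G`: the largest eigenvalue of the real symmetric matrix `A_α(G)`. -/
noncomputable def alphaIndex {V : Type*} [Fintype V] (α : ℝ) (G : SimpleGraph V) : ℝ :=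
  sSup (spectrum ℝ (G.alphaMatrix α))

open Classical in
/-- The supremum in the definition of the `A_α`-index is a maximum. -/
theorem isGreatest_alphaIndex {V : Type*} [Fintype V] [Nonempty V] (α : ℝ)
    (G : SimpleGraph V) :
    IsGreatest (spectrum ℝ (G.alphaMatrix α)) (G.alphaIndex α) := by
  have hA : (G.alphaMatrix α).IsHermitian := by
    ext i j
    by_cases h : i = j
    · subst h
      simp [alphaMatrix, degMatrix]
    · simp [alphaMatrix, degMatrix, adj_comm, h, Ne.symm h]
  have hs := hA.spectrum_real_eq_range_eigenvalues
  have hfin : (spectrum ℝ (G.alphaMatrix α)).Finite := by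
    rw [hs]; exact Set.finite_range _
  have hne : (spectrum ℝ (G.alphaMatrix α)).Nonempty := by
    rw [hs]; exact Set.range_nonempty _
  exact ⟨hne.csSup_mem hfin, fun x hx => le_csSup hfin.bddAbove hx⟩

/-- The graph obtained from `G` by attaching `f v` pendant edges to each vertex `v`. The new
vertices are the pairs `⟨v, i⟩` with `i : Fin (f v)`, and `⟨v, i⟩` is adjacent to `v` only. -/
def attachPendants {V : Type*} (G : SimpleGraph V) (f : V → ℕ) :
    SimpleGraph (V ⊕ (Σ v : V, Fin (f v))) where
  Adj
    | Sum.inl u, Sum.inl v => G.Adj u v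
    | Sum.inl u, Sum.inr p => p.1 = u
    | Sum.inr p, Sum.inl u => p.1 = u
    | Sum.inr _, Sum.inr _ => False
  symm := ⟨by
    rintro (u | p) (v | q) h
    · exact G.adj_symm h
    · exact h
    · exact h
    · exact h⟩
  loopless := ⟨by
    rintro (u | p) h
    · exact G.irrefl h
    · exact h⟩

/-- The number of pendant edges attached to each vertex of the star with `n - τ` vertices and
centre `0`: two at each leaf and `3 τ - 2 n + 2` at the centre. -/
def daggerPendants (n τ : ℕ) (v : Fin (n - τ - 1 + 1)) : ℕ :=
  if v = 0 then 3 * τ + 2 - 2 * n else 2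

/-- The vertices of `S†_{n,τ}`: those of the star `S_{n-τ}` together with the attached leaves. -/
abbrev DaggerVertex (n τ : ℕ) : Type :=
  Fin (n - τ - 1 + 1) ⊕ (Σ v : Fin (n - τ - 1 + 1), Fin (daggerPendants n τ v))

/-- The tree `S†_{n,τ}`: the star `S_{n-τ}`, with two pendant edges attached to each leaf and
`3 τ - 2 n + 2` pendant edges attached to the centre. It is meant for `τ < n` and
`2 n ≤ 3 τ + 2`, where none of the subtractions truncates and `n - τ - 1 + 1 = n - τ`. -/
def daggerTree (n τ : ℕ) : SimpleGraph (DaggerVertex n τ) :=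
  (starGraph (0 : Fin (n - τ - 1 + 1))).attachPendants (daggerPendants n τ)

end SimpleGraph

/-- The quartic `P_α(x)`, with parameters `n` and `τ`. -/
def alphaQuartic (α n τ x : ℝ) : ℝ :=
  x ^ 4 + α * (n - 2 * τ - 6) * x ^ 3
    + (8 * α ^ 2 * τ - 4 * α ^ 2 * n + 4 * α * τ - 2 * α * n - 2 * τ + n
        + 9 * α ^ 2 + 6 * α - 3) * x ^ 2
    + α * (16 * α * n - α ^ 2 * n - 8 * n - 28 * α * τ + 14 * τ - 20 * α + 10) * x
    + 2 * α ^ 3 * n - 17 * α ^ 2 * n + 16 * α * n - 4 * n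
    + 24 * α ^ 2 * τ - 24 * α * τ + 6 * τ - 2 * α ^ 3 + 17 * α ^ 2 - 16 * α + 4

/-! Let `x` be a positive eigenvector of the index of `T`, and root `T` at a vertex `c` where `x` is
largest. A tree contains `n - τ` disjoint three-vertex paths (`exists_packing`), and at most one of
them meets `c`, so `k = n - τ - 1` of them avoid it. In each such path let `z` be a vertex with the
largest entry. Hang `z` from `c`, the other two vertices of the path from `z`, and every remaining
vertex from `c`. This gives `cherryStar k p`, which is the dagger tree, with `p = 3τ + 2 - 2n`. The
quadratic form is a sum over edges joining a vertex to its parent, so the move compares edge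
contributions path by path and cannot lower the form at `x` (`alphaForm_le_cherryStar`). The
Rayleigh bound gives the inequality of indices. In the case of equality `x` is an eigenvector of
both trees, and comparing the two matrices at the root and at the branch vertices recovers all the
parents (`eq_cherryStar`). Eliminating the leaves from the eigenvalue equations of `cherryStar`
yields the quartic, and a monotonicity argument excludes zeros above the index, except possibly for
`n = 3`. -/

namespace SimpleGraph

/-! ### The quadratic form of `A_α` and positive eigenvectors. -/

section AlphaMatrix

variable {V : Type*} [Fintype V]

open Classical in
theorem alphaMatrix_mulVec_apply (α : ℝ) (G : SimpleGraph V) (x : V → ℝ) (v : V) :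
    (G.alphaMatrix α).mulVec x v =
      ∑ u, if G.Adj v u then α * x v + (1 - α) * x u else 0 := by
  have h1 : (∑ u, if G.Adj v u then α * x v + (1 - α) * x u else 0)
      = α * (G.degree v * x v) + (1 - α) * ∑ u, (if G.Adj v u then x u else 0) := by
    have : ∀ u, (if G.Adj v u then α * x v + (1 - α) * x u else 0)
        = (if G.Adj v u then α * x v else 0) + (1 - α) * (if G.Adj v u then x u else 0) := by
      intro u
      split_ifs <;> simp
    rw [Finset.sum_congr rfl fun u _ => this u, Finset.sum_add_distrib, ← Finset.mul_sum,
      ← Finset.sum_filter, Finset.sum_const, ← neighborFinset_eq_filter, card_neighborFinset_eq_degree]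
    simp
    ring
  rw [h1, alphaMatrix, Matrix.add_mulVec, Matrix.smul_mulVec, Matrix.smul_mulVec]
  simp only [Pi.add_apply, Pi.smul_apply, smul_eq_mul, degMatrix, Matrix.mulVec_diagonal,
    adjMatrix_mulVec_apply]
  rw [neighborFinset_eq_filter, Finset.sum_filter]

open Classical in
theorem isHermitian_alphaMatrix (α : ℝ) (G : SimpleGraph V) : (G.alphaMatrix α).IsHermitian := by
  ext i j
  by_cases h : i = j
  · subst h
    simp [alphaMatrix, degMatrix]
  · simp [alphaMatrix, degMatrix, adj_comm, h, Ne.symm h]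

/-- The quadratic form of `A_α(G)`. -/
noncomputable def alphaForm (α : ℝ) (G : SimpleGraph V) (x : V → ℝ) : ℝ :=
  x ⬝ᵥ (G.alphaMatrix α).mulVec x

open Classical in
theorem alphaForm_eq_sum (α : ℝ) (G : SimpleGraph V) (x : V → ℝ) :
    G.alphaForm α x =
      ∑ v, ∑ u, if G.Adj v u then x v * (α * x v + (1 - α) * x u) else 0 := by
  simp only [alphaForm, dotProduct, alphaMatrix_mulVec_apply, Finset.mul_sum, mul_ite, mul_zero]

open Classical in
theorem posSemidef_alphaIndex_sub (α : ℝ) (G : SimpleGraph V) :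
    (G.alphaIndex α • (1 : Matrix V V ℝ) - G.alphaMatrix α).PosSemidef := by
  have hH : (G.alphaIndex α • (1 : Matrix V V ℝ) - G.alphaMatrix α).IsHermitian :=
    (Matrix.isHermitian_one.smul (IsSelfAdjoint.all _)).sub (isHermitian_alphaMatrix α G)
  rw [hH.posSemidef_iff_eigenvalues_nonneg]
  intro i
  have hi : hH.eigenvalues i ∈ spectrum ℝ (G.alphaIndex α • (1 : Matrix V V ℝ) - G.alphaMatrix α) :=
    hH.eigenvalues_mem_spectrum_real i
  simp only [Pi.zero_apply]
  generalize hH.eigenvalues i = r at hi ⊢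
  rw [← Algebra.algebraMap_eq_smul_one, ← spectrum.singleton_sub_eq] at hi
  obtain ⟨_, rfl, b, hb, hab⟩ := hi
  have : Nonempty V := ⟨i⟩
  have := (isGreatest_alphaIndex α G).2 hb
  simp only at hab
  linarith

theorem alphaForm_le (α : ℝ) (G : SimpleGraph V) (x : V → ℝ) :
    G.alphaForm α x ≤ G.alphaIndex α * (x ⬝ᵥ x) := by
  classical
  have := (posSemidef_alphaIndex_sub α G).dotProduct_mulVec_nonneg x
  rw [Matrix.sub_mulVec, Matrix.smul_mulVec, Matrix.one_mulVec, star_trivial, dotProduct_sub,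
    dotProduct_smul, smul_eq_mul] at this
  rw [alphaForm]
  linarith

/-- A vector on which a positive semidefinite form vanishes lies in the kernel of its matrix. -/
theorem mulVec_eq_of_alphaForm_eq {α : ℝ} {G : SimpleGraph V} {x : V → ℝ}
    (h : G.alphaForm α x = G.alphaIndex α * (x ⬝ᵥ x)) :
    (G.alphaMatrix α).mulVec x = G.alphaIndex α • x := by
  classical
  have := ((posSemidef_alphaIndex_sub α G).dotProduct_mulVec_zero_iff x).1 (by
    rw [Matrix.sub_mulVec, Matrix.smul_mulVec, Matrix.one_mulVec, star_trivial, dotProduct_sub,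
      dotProduct_smul, smul_eq_mul, ← alphaForm, h, sub_self])
  rw [Matrix.sub_mulVec, Matrix.smul_mulVec, Matrix.one_mulVec] at this
  exact (sub_eq_zero.1 this).symm

/-- Taking absolute values in an eigenvector keeps its norm and does not lower the form, so the
result still attains the Rayleigh bound. -/
theorem exists_nonneg_eigenvector [Nonempty V] {α : ℝ} (hα₀ : 0 ≤ α) (hα₁ : α ≤ 1)
    (G : SimpleGraph V) :
    ∃ x : V → ℝ, (∀ v, 0 ≤ x v) ∧ x ≠ 0 ∧
      (G.alphaMatrix α).mulVec x = G.alphaIndex α • x := by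
  classical
  have hmem := (isGreatest_alphaIndex α G).1
  rw [← Matrix.spectrum_toLin', ← Module.End.hasEigenvalue_iff_mem_spectrum] at hmem
  obtain ⟨y, hy⟩ := hmem.exists_hasEigenvector
  have hy1 : (G.alphaMatrix α).mulVec y = G.alphaIndex α • y := by
    simpa using hy.apply_eq_smul
  have hy0 : y ≠ 0 := hy.2
  refine ⟨fun v => |y v|, fun v => abs_nonneg _, ?_, mulVec_eq_of_alphaForm_eq ?_⟩
  · intro h
    exact hy0 (funext fun v => abs_eq_zero.1 (congrFun h v))
  · apply le_antisymm (alphaForm_le α G _)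
    have h1 : (fun v => |y v|) ⬝ᵥ (fun v => |y v|) = y ⬝ᵥ y := by
      simp [dotProduct]
    have h2 : G.alphaForm α y = G.alphaIndex α * (y ⬝ᵥ y) := by
      rw [alphaForm, hy1, dotProduct_smul, smul_eq_mul]
    rw [h1, ← h2, alphaForm_eq_sum, alphaForm_eq_sum]
    refine Finset.sum_le_sum fun v _ => Finset.sum_le_sum fun u _ => ?_
    split_ifs
    · have e1 : |y v| * |y v| = y v * y v := abs_mul_abs_self _
      have e2 : y v * y u ≤ |y v| * |y u| := by
        rw [← abs_mul]; exact le_abs_self _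
      have := mul_le_mul_of_nonneg_left e2 (sub_nonneg.2 hα₁)
      nlinarith
    · rfl

/-- At a zero entry the eigenvalue equation says that a sum of nonnegative terms `(1 - α) * x u`
over the neighbours vanishes. Zeros therefore spread along walks. -/
theorem Connected.pos_of_mulVec_eq {α : ℝ} (hα₁ : α < 1) {G : SimpleGraph V}
    (hG : G.Connected) {μ : ℝ} {x : V → ℝ} (hx : ∀ v, 0 ≤ x v) (hx0 : x ≠ 0)
    (h : (G.alphaMatrix α).mulVec x = μ • x) (v : V) : 0 < x v := by
  classical
  have key : ∀ a b, G.Adj a b → x a = 0 → x b = 0 := by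
    intro a b hab ha
    have h1 := congrFun h a
    rw [alphaMatrix_mulVec_apply, Pi.smul_apply, ha, smul_zero] at h1
    have h2 := (Finset.sum_eq_zero_iff_of_nonneg (by
      intro u _
      split_ifs
      · have := mul_nonneg (sub_nonneg.2 hα₁.le) (hx u)
        simpa using this
      · rfl)).1 h1 b (Finset.mem_univ b)
    simpa [hab, (sub_pos.2 hα₁).ne'] using h2
  rcases (hx v).lt_or_eq with hv | hv
  · exact hv
  · exfalso
    apply hx0
    funext w
    obtain ⟨p⟩ := hG.preconnected v w
    have : ∀ (a b : V), G.Walk a b → x a = 0 → x b = 0 := by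
      intro a b p
      induction p with
      | nil => exact id
      | cons hab _ ih => exact fun ha => ih (key _ _ hab ha)
    exact this v w p hv.symm

variable {W : Type*} [Fintype W]

theorem alphaForm_comp_iso (α : ℝ) {G : SimpleGraph V} {H : SimpleGraph W} (e : G ≃g H)
    (x : W → ℝ) : G.alphaForm α (x ∘ e) = H.alphaForm α x := by
  classical
  rw [alphaForm_eq_sum, alphaForm_eq_sum, ← e.toEquiv.sum_comp]
  refine Finset.sum_congr rfl fun v _ => ?_
  rw [← e.toEquiv.sum_comp]
  exact Finset.sum_congr rfl fun u _ => if_congr e.map_adj_iff.symm rfl rfl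

theorem Iso.alphaMatrix_eq_submatrix (α : ℝ) {G : SimpleGraph V} {H : SimpleGraph W}
    (e : G ≃g H) : G.alphaMatrix α = (H.alphaMatrix α).submatrix e e := by
  classical
  ext i j
  by_cases h : i = j
  · subst h
    simp [alphaMatrix, degMatrix, e.degree_eq]
  · simp [alphaMatrix, degMatrix, h, e.map_adj_iff, adjMatrix_apply]

theorem Iso.alphaIndex_eq (α : ℝ) {G : SimpleGraph V} {H : SimpleGraph W} (e : G ≃g H) :
    G.alphaIndex α = H.alphaIndex α := by
  classical
  have h := AlgEquiv.spectrum_eq (Matrix.reindexAlgEquiv ℝ ℝ e.toEquiv.symm) (H.alphaMatrix α)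
  have h2 : Matrix.reindexAlgEquiv ℝ ℝ e.toEquiv.symm (H.alphaMatrix α) = G.alphaMatrix α := by
    rw [e.alphaMatrix_eq_submatrix α]
    rfl
  rw [h2] at h
  rw [alphaIndex, alphaIndex, h]

end AlphaMatrix

end SimpleGraph

/-! ### Rooted trees described by parent functions. -/

namespace SimpleGraph

section Rooted

variable {V : Type*}

/-- `G` is the rooted tree with root `c` in which `par v` is the parent of a vertex `v ≠ c`. -/
structure IsRootedBy (G : SimpleGraph V) (c : V) (par : V → V) : Prop where
  adj_iff : ∀ u v, G.Adj u v ↔ (u ≠ c ∧ par u = v) ∨ (v ≠ c ∧ par v = u)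
  par_root : par c = c
  depth : ∃ d : V → ℕ, ∀ v, v ≠ c → d (par v) < d v

/-- The parent is the neighbour one step closer to `c`. Two such neighbours would extend to two
different paths from `c` to the same vertex. -/
theorem IsTree.exists_isRootedBy {G : SimpleGraph V} (hG : G.IsTree) (c : V) :
    ∃ par, G.IsRootedBy c par := by
  classical
  have hex : ∀ v, v ≠ c → ∃ u, G.Adj v u ∧ G.dist c v = G.dist c u + 1 := by
    intro v hv
    obtain ⟨p, hp⟩ := hG.connected.exists_walk_length_eq_dist v c
    cases p with
    | nil => exact absurd rfl hv
    | @cons _ u _ h q =>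
      refine ⟨u, h, ?_⟩
      rw [Walk.length_cons] at hp
      have h1 := G.dist_le q
      rcases hG.dist_eq_dist_add_one_of_adj c h with h2 | h2
      · exact h2
      · rw [dist_comm] at hp h1
        omega
  have huniq : ∀ v u w, G.Adj v u → G.Adj v w → G.dist c v = G.dist c u + 1 →
      G.dist c v = G.dist c w + 1 → u = w := by
    intro v u w hu hw hdu hdw
    obtain ⟨p, hp⟩ := hG.connected.exists_walk_length_eq_dist c u
    obtain ⟨q, hq⟩ := hG.connected.exists_walk_length_eq_dist c w
    have h1 : (p.concat hu.symm).IsPath :=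
      Walk.isPath_of_length_eq_dist _ (by rw [Walk.length_concat]; omega)
    have h2 : (q.concat hw.symm).IsPath :=
      Walk.isPath_of_length_eq_dist _ (by rw [Walk.length_concat]; omega)
    have h3 := congrArg Subtype.val 
      ((hG.isAcyclic.subsingleton_path c v).elim ⟨_, h1⟩ ⟨_, h2⟩)
    exact (Walk.concat_inj h3).1
  choose! par hpar using hex
  refine ⟨fun v => if v = c then c else par v, ⟨fun u v => ?_, by simp, G.dist c, fun v hv => ?_⟩⟩
  · constructor
    · intro h
      rcases hG.dist_eq_dist_add_one_of_adj c h with h2 | h2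
      · have hu : u ≠ c := by
          rintro rfl
          simp at h2
        left
        exact ⟨hu, by
          rw [if_neg hu]
          exact huniq u _ _ (hpar u hu).1 h (hpar u hu).2 h2⟩
      · have hv : v ≠ c := by
          rintro rfl
          simp at h2
        right
        exact ⟨hv, by
          rw [if_neg hv]
          exact huniq v _ _ (hpar v hv).1 h.symm (hpar v hv).2 h2⟩
    · rintro (⟨hu, rfl⟩ | ⟨hv, rfl⟩)
      · rw [if_neg hu]
        exact (hpar u hu).1
      · rw [if_neg hv]
        exact (hpar v hv).1.symm
  · simp only [if_neg hv]
    have := (hpar v hv).2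
    omega

namespace IsRootedBy

variable {G : SimpleGraph V} {c : V} {par : V → V}

theorem par_ne (h : G.IsRootedBy c par) {v : V} (hv : v ≠ c) : par v ≠ v := by
  obtain ⟨d, hd⟩ := h.depth
  intro h1
  have := hd v hv
  rw [h1] at this
  exact lt_irrefl _ this

theorem par_par_ne (h : G.IsRootedBy c par) {u v : V} (hu : u ≠ c) (hv : v ≠ c)
    (huv : par u = v) : par v ≠ u := by
  obtain ⟨d, hd⟩ := h.depth
  intro h1
  have h2 := hd v hv
  have h3 := hd u hu
  rw [h1] at h2
  rw [huv] at h3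
  omega

theorem comap {W : Type*} (h : G.IsRootedBy c par) (e : W ≃ V) :
    (G.comap e).IsRootedBy (e.symm c) (fun w => e.symm (par (e w))) := by
  obtain ⟨d, hd⟩ := h.depth
  refine ⟨fun u v => ?_, by simp [h.par_root], fun w => d (e w), fun w hw => ?_⟩
  · simp [h.adj_iff, Equiv.eq_symm_apply, Equiv.symm_apply_eq]
  · simpa using hd (e w) (by simpa [Equiv.eq_symm_apply] using hw)

theorem eq_of_par_eq {H : SimpleGraph V} {par' : V → V} (h : G.IsRootedBy c par)
    (h' : H.IsRootedBy c par') (hp : ∀ v, v ≠ c → par v = par' v) : G = H := by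
  ext u v
  rw [h.adj_iff, h'.adj_iff]
  refine or_congr (and_congr_right fun hu => ?_) (and_congr_right fun hv => ?_)
  · rw [hp u hu]
  · rw [hp v hv]

/-- Passing to parents lowers the depth until `c` is reached, which gives connectedness. Each edge
joins some `v ≠ c` to its parent, so there are too few edges for a cycle. -/
theorem isTree [Finite V] (h : G.IsRootedBy c par) : G.IsTree := by
  classical
  have := Fintype.ofFinite V
  obtain ⟨d, hd⟩ := h.depth
  have hr : ∀ n v, d v ≤ n → G.Reachable v c := by
    intro n
    induction n with
    | zero =>
      intro v hv
      by_cases hc : v = c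
      · rw [hc]
      · have := hd v hc
        omega
    | succ n ih =>
      intro v hv
      by_cases hc : v = c
      · rw [hc]
      · have h1 := hd v hc
        have h2 : G.Adj v (par v) := (h.adj_iff _ _).2 (Or.inl ⟨hc, rfl⟩)
        exact h2.reachable.trans (ih _ (by omega))
  have hconn : G.Connected :=
    { preconnected := fun u v => (hr _ u le_rfl).trans (hr _ v le_rfl).symm
      nonempty := ⟨c⟩ }
  refine isTree_iff_connected_and_card.2 ⟨hconn, le_antisymm ?_
    hconn.card_vert_le_card_edgeSet_add_one⟩
  have hsub : G.edgeFinset ⊆ (Finset.univ.erase c).image fun v => s(v, par v) := by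
    intro e
    induction e using Sym2.ind with
    | _ u v =>
      rw [mem_edgeFinset, mem_edgeSet, h.adj_iff]
      rintro (⟨hu, rfl⟩ | ⟨hv, rfl⟩)
      · exact Finset.mem_image.2 ⟨u, by simp [hu], rfl⟩
      · exact Finset.mem_image.2 ⟨v, by simp [hv], Sym2.eq_swap⟩
  have h1 := (Finset.card_le_card hsub).trans Finset.card_image_le
  rw [Finset.card_erase_of_mem (Finset.mem_univ c), Finset.card_univ] at h1
  have h2 : 0 < Fintype.card V := Fintype.card_pos_iff.2 ⟨c⟩
  rw [Nat.card_eq_fintype_card, Nat.card_eq_fintype_card, ← edgeFinset_card]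
  omega

end IsRootedBy

section Forms

variable [Fintype V] {G : SimpleGraph V} {c : V} {par : V → V}

open Classical in
theorem IsRootedBy.sum_adj (h : G.IsRootedBy c par) (F : V → V → ℝ) (v : V) :
    (∑ u, if G.Adj v u then F v u else 0) =
      (if v ≠ c then F v (par v) else 0) + ∑ u with u ≠ c ∧ par u = v, F v u := by
  have : ∀ u, (if G.Adj v u then F v u else 0) =
      (if v ≠ c ∧ par v = u then F v u else 0) + (if u ≠ c ∧ par u = v then F v u else 0) := by
    intro u
    simp only [h.adj_iff]
    by_cases h1 : v ≠ c ∧ par v = u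
    · have h2 : ¬ (u ≠ c ∧ par u = v) := fun h2 => h.par_par_ne h1.1 h2.1 h1.2 h2.2
      rw [if_pos (Or.inl h1), if_pos h1, if_neg h2, add_zero]
    · by_cases h2 : u ≠ c ∧ par u = v
      · rw [if_pos (Or.inr h2), if_neg h1, if_pos h2, zero_add]
      · rw [if_neg (by tauto), if_neg h1, if_neg h2, zero_add]
  rw [Finset.sum_congr rfl fun u _ => this u, Finset.sum_add_distrib, ← Finset.sum_filter]
  congr 1
  · by_cases hv : v = c
    · simp [hv]
    · simp [hv, Finset.sum_filter]
  · rw [Finset.sum_filter]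

/-- The contribution of an edge, with values `a` and `b` at its ends, to the quadratic form of
`A_α`. -/
def edgeForm (α a b : ℝ) : ℝ := α * (a ^ 2 + b ^ 2) + 2 * (1 - α) * (a * b)

open Classical in
theorem IsRootedBy.alphaForm_eq (h : G.IsRootedBy c par) (α : ℝ) (x : V → ℝ) :
    G.alphaForm α x = ∑ v with v ≠ c, edgeForm α (x v) (x (par v)) := by
  rw [alphaForm_eq_sum, Finset.sum_congr rfl fun v _ =>
    h.sum_adj (fun v u => x v * (α * x v + (1 - α) * x u)) v, Finset.sum_add_distrib,
    ← Finset.sum_filter]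
  -- Exchanging the sums charges each edge to its lower end, where it meets the other half of its
  -- contribution.
  have : ∑ v, ∑ u with u ≠ c ∧ par u = v, x v * (α * x v + (1 - α) * x u) =
      ∑ u with u ≠ c, x (par u) * (α * x (par u) + (1 - α) * x u) := by
    simp only [Finset.sum_filter]
    rw [Finset.sum_comm]
    refine Finset.sum_congr rfl fun u _ => ?_
    by_cases hu : u = c
    · simp [hu]
    · simp [hu]
  rw [this, ← Finset.sum_add_distrib]
  refine Finset.sum_congr rfl fun v _ => ?_
  rw [edgeForm]
  ring

open Classical in
theorem IsRootedBy.mulVec_apply (h : G.IsRootedBy c par) (α : ℝ) (x : V → ℝ) (v : V) :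
    (G.alphaMatrix α).mulVec x v =
      (if v ≠ c then α * x v + (1 - α) * x (par v) else 0) +
        ∑ u with u ≠ c ∧ par u = v, (α * x v + (1 - α) * x u) := by
  rw [alphaMatrix_mulVec_apply]
  exact h.sum_adj (fun v u => α * x v + (1 - α) * x u) v

/-- If two trees with the same root act in the same way on a positive vector at `v`, if `v` has
the same parent in both, and if its children in the first are children in the second, then the
children are the same. -/
theorem IsRootedBy.par_eq_of_mulVec_eq {H : SimpleGraph V} {par' : V → V} (h : G.IsRootedBy c par)
    (h' : H.IsRootedBy c par') {α : ℝ} (hα₀ : 0 ≤ α) (hα₁ : α < 1) {x : V → ℝ}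
    (hx : ∀ v, 0 < x v) {v : V}
    (heq : (G.alphaMatrix α).mulVec x v = (H.alphaMatrix α).mulVec x v)
    (hpar : v ≠ c → par v = par' v) (hsub : ∀ u, u ≠ c → par u = v → par' u = v)
    (u : V) (hu : u ≠ c) (huv : par' u = v) : par u = v := by
  classical
  rw [h.mulVec_apply, h'.mulVec_apply] at heq
  have h1 : (if v ≠ c then α * x v + (1 - α) * x (par v) else 0) =
      if v ≠ c then α * x v + (1 - α) * x (par' v) else 0 := by
    by_cases hv : v = c
    · simp [hv]
    · simp [hv, hpar hv]
  rw [h1, add_right_inj] at heq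
  by_contra hne
  have hss : (Finset.univ.filter fun u => u ≠ c ∧ par u = v) ⊆
      Finset.univ.filter fun u => u ≠ c ∧ par' u = v := by
    intro w hw
    simp only [Finset.mem_filter, Finset.mem_univ, true_and] at hw ⊢
    exact ⟨hw.1, hsub w hw.1 hw.2⟩
  -- Each child contributes a positive amount, so an additional child would make the sum strictly
  -- larger.
  have hpos : ∀ w, 0 < α * x v + (1 - α) * x w := fun w =>
    add_pos_of_nonneg_of_pos (mul_nonneg hα₀ (hx v).le) (mul_pos (sub_pos.2 hα₁) (hx w))
  refine absurd heq (ne_of_lt (Finset.sum_lt_sum_of_subset hss (i := u) ?_ ?_ (hpos u)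
    fun w _ _ => (hpos w).le))
  · simp [hu, huv]
  · simp [hne]

end Forms

end Rooted

end SimpleGraph

/-! ### Packing disjoint three-vertex paths. -/

namespace SimpleGraph

section Packing

variable {V : Type*}

/-- `(t, m, b)` are the vertices of a path with three vertices in a rooted tree: `m` is a child of
`t`, and `b` is another child of `t` or a child of `m`. -/
structure IsRootedPath (c : V) (par : V → V) (q : V × V × V) : Prop where
  mid_ne : q.2.1 ≠ c
  par_mid : par q.2.1 = q.1
  bot_ne : q.2.2 ≠ c
  bot_ne_mid : q.2.2 ≠ q.2.1
  par_bot : par q.2.2 = q.1 ∨ par q.2.2 = q.2.1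

open Classical in
/-- The finite set of the entries of a triple. -/
noncomputable def tripleSupport (q : V × V × V) : Finset V := {q.1, q.2.1, q.2.2}

theorem mem_tripleSupport {q : V × V × V} {v : V} :
    v ∈ tripleSupport q ↔ v = q.1 ∨ v = q.2.1 ∨ v = q.2.2 := by
  simp [tripleSupport]

namespace IsRootedBy

variable {G : SimpleGraph V} {c : V} {par : V → V}

theorem top_ne_mid (h : G.IsRootedBy c par) {q : V × V × V} (hq : IsRootedPath c par q) :
    q.1 ≠ q.2.1 := fun h1 => h.par_ne hq.mid_ne (hq.par_mid.trans h1)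

theorem top_ne_bot (h : G.IsRootedBy c par) {q : V × V × V} (hq : IsRootedPath c par q) :
    q.1 ≠ q.2.2 := by
  intro h1
  rcases hq.par_bot with h2 | h2
  · exact h.par_ne hq.bot_ne (h2.trans h1)
  · exact h.par_par_ne hq.bot_ne hq.mid_ne h2 (hq.par_mid.trans h1)

theorem card_tripleSupport (h : G.IsRootedBy c par) {q : V × V × V}
    (hq : IsRootedPath c par q) : (tripleSupport q).card = 3 := by
  classical
  rw [tripleSupport, Finset.card_eq_three]
  exact ⟨_, _, _, h.top_ne_mid hq, h.top_ne_bot hq, hq.bot_ne_mid.symm, by congr!⟩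

/-- Of two distinct neighbours of a vertex at most one is its parent, so the vertex is either the
middle of a descending path or the top of two children. -/
theorem exists_isRootedPath (h : G.IsRootedBy c par) {R : Finset V}
    (hR : ¬ G.IsDissociationSet R) :
    ∃ q, IsRootedPath c par q ∧ tripleSupport q ⊆ R := by
  simp only [IsDissociationSet, not_forall] at hR
  obtain ⟨v, hv, u, hu, w, hw, hvu, hvw, hne⟩ := hR
  have hsub : ∀ a b d, a ∈ R → b ∈ R → d ∈ R → tripleSupport (a, b, d) ⊆ R := by
    intro a b d ha hb hd z hz
    rw [mem_tripleSupport] at hz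
    rcases hz with rfl | rfl | rfl <;> assumption
  rcases (h.adj_iff _ _).1 hvu with ⟨h1, h2⟩ | ⟨h1, h2⟩
  · rcases (h.adj_iff _ _).1 hvw with ⟨h3, h4⟩ | ⟨h3, h4⟩
    · exact absurd (h2.symm.trans h4) hne
    · exact ⟨(u, v, w), ⟨h1, h2, h3, hvw.ne', Or.inr h4⟩, hsub _ _ _ hu hv hw⟩
  · rcases (h.adj_iff _ _).1 hvw with ⟨h3, h4⟩ | ⟨h3, h4⟩
    · exact ⟨(w, v, u), ⟨h3, h4, h1, hvu.ne', Or.inr h2⟩, hsub _ _ _ hw hv hu⟩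
    · exact ⟨(v, u, w), ⟨h1, h2, h3, Ne.symm hne, Or.inl h4⟩, hsub _ _ _ hv hu hw⟩

/-- In every set `R` of vertices of a tree there are a dissociation set and disjoint paths with
three vertices, as many as there are vertices of `R` outside the dissociation set. -/
theorem exists_packing (h : G.IsRootedBy c par) (R : Finset V) :
    ∃ (S : Finset V) (P : Finset (V × V × V)), S ⊆ R ∧ G.IsDissociationSet S ∧
      (∀ q ∈ P, IsRootedPath c par q ∧ tripleSupport q ⊆ R) ∧
      (P : Set (V × V × V)).PairwiseDisjoint tripleSupport ∧ R.card ≤ S.card + P.card := by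
  classical
  obtain ⟨d, hd⟩ := h.depth
  induction R using Finset.strongInduction with
  | H R ih =>
  by_cases hR : G.IsDissociationSet R
  · exact ⟨R, ∅, subset_rfl, hR, by simp, by simp, by simp⟩
  let C := (R ×ˢ R ×ˢ R).filter fun q => IsRootedPath c par q
  have hC : ∀ q, IsRootedPath c par q → tripleSupport q ⊆ R → q ∈ C := by
    intro q hq hs
    simp only [C, Finset.mem_filter, Finset.mem_product]
    exact ⟨⟨hs (mem_tripleSupport.2 (by tauto)), hs (mem_tripleSupport.2 (by tauto)),
      hs (mem_tripleSupport.2 (by tauto))⟩, hq⟩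
  obtain ⟨q₀, hq₀, hs₀⟩ := h.exists_isRootedPath hR
  -- Take a path whose top `t` is as deep as possible and split off the set `D` of descendants of
  -- `t` in `R`. Any path inside `D` without `t` would have a deeper top, so `D.erase t` is a
  -- dissociation set. The one lost vertex `t` is paid for by the path `(t, m, b)`.
  obtain ⟨⟨t, m, b⟩, hq, hmax⟩ := Finset.exists_max_image C (fun q => d q.1) ⟨q₀, hC _ hq₀ hs₀⟩
  simp only [C, Finset.mem_filter, Finset.mem_product] at hq
  obtain ⟨⟨htR, hmR, hbR⟩, hq⟩ := hq
  let D := R.filter fun u => ∃ j : ℕ, par^[j] u = t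
  have htD : t ∈ D := Finset.mem_filter.2 ⟨htR, 0, rfl⟩
  have hDR : D ⊆ R := Finset.filter_subset _ _
  have hchild : ∀ u v, v ∈ R → u ∈ D → par v = u → v ∈ D := by
    intro u v hv hu huv
    obtain ⟨j, hj⟩ := (Finset.mem_filter.1 hu).2
    exact Finset.mem_filter.2 ⟨hv, j + 1, by rw [Function.iterate_succ_apply, huv, hj]⟩
  have hmD : m ∈ D := hchild t m hmR htD hq.par_mid
  have hbD : b ∈ D := by
    rcases hq.par_bot with h1 | h1
    · exact hchild t b hbR htD h1
    · exact hchild m b hbR hmD h1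
  have hdepth : ∀ (j : ℕ) (u : V), par^[j] u = t → u = t ∨ d t < d u := by
    intro j
    induction j with
    | zero => exact fun u hu => Or.inl hu
    | succ j ihj =>
      intro u hu
      rw [Function.iterate_succ_apply] at hu
      by_cases huc : u = c
      · have := ihj _ hu
        rwa [huc, h.par_root, ← huc] at this
      · have h1 := hd u huc
        rcases ihj _ hu with h2 | h2
        · right
          rwa [h2] at h1
        · right
          omega
  have hpar : ∀ u v, u ∈ D → u ≠ t → v ∈ R → par u = v → v ∈ D := by
    intro u v hu hut hv huv
    obtain ⟨j, hj⟩ := (Finset.mem_filter.1 hu).2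
    cases j with
    | zero => exact absurd hj hut
    | succ j =>
      rw [Function.iterate_succ_apply, huv] at hj
      exact Finset.mem_filter.2 ⟨hv, j, hj⟩
  -- Only `t` can have neighbours in `R` outside `D`, so dissociation sets on the two sides can be
  -- united once `t` is dropped.
  have hsep : ∀ u v, u ∈ D → u ≠ t → v ∈ R → G.Adj u v → v ∈ D := by
    intro u v hu hut hv huv
    rcases (h.adj_iff _ _).1 huv with ⟨-, h1⟩ | ⟨-, h1⟩
    · exact hpar u v hu hut hv h1
    · exact hchild u v hv hu h1
  obtain ⟨S, P, hSR, hS, hP, hPd, hcard⟩ := ih (R \ D) (Finset.sdiff_ssubset hDR ⟨t, htD⟩)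
  have hDiss : G.IsDissociationSet (D.erase t) := by
    by_contra hno
    obtain ⟨q', hq', hs'⟩ := h.exists_isRootedPath hno
    have h1 : q'.1 ∈ D.erase t := hs' (mem_tripleSupport.2 (Or.inl rfl))
    rw [Finset.mem_erase] at h1
    obtain ⟨j, hj⟩ := (Finset.mem_filter.1 h1.2).2
    have h2 := hmax q' (hC q' hq' (hs'.trans ((Finset.erase_subset _ _).trans hDR)))
    rcases hdepth j _ hj with h3 | h3
    · exact h1.1 h3
    · simp only at h2
      omega
  have hdisj : Disjoint S (D.erase t) := by
    rw [Finset.disjoint_left]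
    intro a ha ha'
    exact (Finset.mem_sdiff.1 (hSR ha)).2 (Finset.mem_of_mem_erase ha')
  have hside : ∀ v ∈ D.erase t, ∀ u ∈ S ∪ D.erase t, G.Adj v u → u ∈ D.erase t := by
    intro v hv u hu hvu
    rcases Finset.mem_union.1 hu with hu | hu
    · have h1 := Finset.mem_sdiff.1 (hSR hu)
      rw [Finset.mem_erase] at hv
      exact absurd (hsep v u hv.2 hv.1 h1.1 hvu) h1.2
    · exact hu
  have hside' : ∀ v ∈ S, ∀ u ∈ S ∪ D.erase t, G.Adj v u → u ∈ S := by
    intro v hv u hu hvu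
    rcases Finset.mem_union.1 hu with hu | hu
    · exact hu
    · have := hside u hu v (Finset.mem_union_left _ hv) hvu.symm
      exact absurd this (Finset.disjoint_left.1 hdisj hv)
  have hnew : ∀ q ∈ P, Disjoint (tripleSupport (t, m, b)) (tripleSupport q) := by
    intro q hqP
    rw [Finset.disjoint_left]
    intro a ha ha'
    have h1 := (Finset.mem_sdiff.1 ((hP q hqP).2 ha')).2
    rw [mem_tripleSupport] at ha
    rcases ha with rfl | rfl | rfl
    · exact h1 htD
    · exact h1 hmD
    · exact h1 hbD
  have hnotin : (t, m, b) ∉ P := by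
    intro hin
    have := Finset.disjoint_left.1 (hnew _ hin) (mem_tripleSupport.2 (Or.inl rfl))
    exact this (mem_tripleSupport.2 (Or.inl rfl))
  refine ⟨S ∪ D.erase t, insert (t, m, b) P, ?_, ?_, ?_, ?_, ?_⟩
  · exact Finset.union_subset (hSR.trans Finset.sdiff_subset)
      ((Finset.erase_subset _ _).trans hDR)
  · intro v hv u hu w hw hvu hvw
    rcases Finset.mem_union.1 hv with hv | hv
    · exact hS v hv u (hside' v hv u hu hvu) w (hside' v hv w hw hvw) hvu hvw
    · exact hDiss v hv u (hside v hv u hu hvu) w (hside v hv w hw hvw) hvu hvw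
  · intro q hqP
    rcases Finset.mem_insert.1 hqP with rfl | hqP
    · refine ⟨hq, fun a ha => ?_⟩
      rw [mem_tripleSupport] at ha
      rcases ha with rfl | rfl | rfl <;> assumption
    · exact ⟨(hP q hqP).1, (hP q hqP).2.trans Finset.sdiff_subset⟩
  · rw [Finset.coe_insert, Set.pairwiseDisjoint_insert]
    exact ⟨hPd, fun q hqP _ => hnew q hqP⟩
  · rw [Finset.card_union_of_disjoint hdisj, Finset.card_insert_of_notMem hnotin,
      Finset.card_erase_of_mem htD]
    rw [Finset.card_sdiff_of_subset hDR] at hcard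
    have h1 := Finset.card_le_card hDR
    have h2 := Finset.card_pos.2 ⟨t, htD⟩
    omega

variable [Fintype V]

theorem exists_disjoint_triples (h : G.IsRootedBy c par) :
    ∃ P : Finset (V × V × V), (∀ q ∈ P, IsRootedPath c par q) ∧
      (P : Set (V × V × V)).PairwiseDisjoint tripleSupport ∧
      Fintype.card V ≤ G.dissociationNumber + P.card := by
  obtain ⟨S, P, -, hS, hP, hd, hcard⟩ := h.exists_packing Finset.univ
  refine ⟨P, fun q hq => (hP q hq).1, hd, ?_⟩
  have := (isGreatest_dissociationNumber G).2 ⟨S, hS, rfl⟩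
  rw [Finset.card_univ] at hcard
  omega

/-- The disjoint triples, at least `n - τ` of them, fit into `n` vertices. This makes the number of
pendant edges at the centre at least two. -/
theorem three_mul_le (h : G.IsRootedBy c par) :
    3 * Fintype.card V ≤ 3 * G.dissociationNumber + Fintype.card V := by
  classical
  obtain ⟨P, hP, hd, hcard⟩ := h.exists_disjoint_triples
  have h1 := Finset.card_biUnion hd
  rw [Finset.sum_congr rfl fun q hq => h.card_tripleSupport (hP q hq)] at h1
  have h2 := Finset.card_le_univ (P.biUnion tripleSupport)
  rw [h1] at h2
  simp only [Finset.sum_const, smul_eq_mul] at h2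
  omega

/-- All but at most one of the triples avoid the root. -/
theorem exists_triples_avoiding_root (h : G.IsRootedBy c par) {k : ℕ}
    (hk : k + 1 + G.dissociationNumber ≤ Fintype.card V) :
    ∃ q : Fin k → V × V × V, (∀ i, IsRootedPath c par (q i)) ∧ (∀ i, (q i).1 ≠ c) ∧
      Pairwise fun i j => Disjoint (tripleSupport (q i)) (tripleSupport (q j)) := by
  classical
  obtain ⟨P, hP, hd, hcard⟩ := h.exists_disjoint_triples
  -- The root can only be the top of a path, and two paths with the same top are not disjoint.
  have h1 : (P.filter fun q => q.1 = c).card ≤ 1 := by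
    rw [Finset.card_le_one]
    intro a ha b hb
    rw [Finset.mem_filter] at ha hb
    by_contra hne
    exact Finset.disjoint_left.1 (hd ha.1 hb.1 hne) (mem_tripleSupport.2 (Or.inl rfl))
      (mem_tripleSupport.2 (Or.inl (ha.2.trans hb.2.symm)))
  have h2 := Finset.card_filter_add_card_filter_not (s := P) (fun q => q.1 = c)
  obtain ⟨Q, hQ, hQk⟩ := Finset.exists_subset_card_eq
    (show k ≤ (P.filter fun q => ¬ q.1 = c).card by omega)
  have hQ' : ∀ q ∈ Q, q ∈ P ∧ q.1 ≠ c := fun q hq => Finset.mem_filter.1 (hQ hq)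
  let e := (Q.equivFinOfCardEq hQk).symm
  refine ⟨fun i => (e i).1, fun i => hP _ (hQ' _ (e i).2).1, fun i => (hQ' _ (e i).2).2, ?_⟩
  intro i j hij
  exact hd (hQ' _ (e i).2).1 (hQ' _ (e j).2).1 fun h => hij (e.injective (Subtype.ext h))

end IsRootedBy

/-- Otherwise all degrees are at most one, against the degree sum `2 (n - 1)` of a tree. -/
theorem IsTree.dissociationNumber_lt_card [Fintype V] {G : SimpleGraph V} (hG : G.IsTree)
    (h3 : 3 ≤ Fintype.card V) : G.dissociationNumber < Fintype.card V := by
  classical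
  obtain ⟨S, hS, hcard⟩ := (isGreatest_dissociationNumber G).1
  rw [← hcard]
  refine lt_of_le_of_ne (Finset.card_le_univ S) fun heq => ?_
  rw [Finset.card_eq_iff_eq_univ] at heq
  subst heq
  have h1 : ∀ v, G.degree v ≤ 1 := by
    intro v
    rw [← card_neighborFinset_eq_degree, Finset.card_le_one]
    intro u hu w hw
    rw [mem_neighborFinset] at hu hw
    exact hS v (Finset.mem_univ v) u (Finset.mem_univ u) w (Finset.mem_univ w) hu hw
  have h2 := G.sum_degrees_eq_twice_card_edges
  have h4 := Finset.sum_le_sum fun v (_ : v ∈ Finset.univ) => h1 v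
  have h5 := hG.card_edgeFinset
  simp only [Finset.sum_const, Finset.card_univ, smul_eq_mul, mul_one] at h4
  omega

end Packing

end SimpleGraph

/-! ### The extremal tree. -/

namespace SimpleGraph

section CherryStar

/-- The parent function of the tree `cherryStar k p`. -/
def cherryParent (k p : ℕ) : Option (Fin p ⊕ Fin k × Fin 3) → Option (Fin p ⊕ Fin k × Fin 3)
  | none => none
  | some (Sum.inl _) => none
  | some (Sum.inr (i, l)) => if l = 0 then none else some (Sum.inr (i, 0))

theorem cherryParent_branch_zero {k p : ℕ} (i : Fin k) :
    cherryParent k p (some (Sum.inr (i, 0))) = none := rfl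

theorem cherryParent_branch_of_ne {k p : ℕ} (i : Fin k) {l : Fin 3} (hl : l ≠ 0) :
    cherryParent k p (some (Sum.inr (i, l))) = some (Sum.inr (i, 0)) := by
  simp [cherryParent, hl]

/-- The tree whose root `none` has `p` children that are leaves, and `k` children
`some (Sum.inr (i, 0))` that have two leaves as their children. -/
def cherryStar (k p : ℕ) : SimpleGraph (Option (Fin p ⊕ Fin k × Fin 3)) where
  Adj u v := (u ≠ none ∧ cherryParent k p u = v) ∨ (v ≠ none ∧ cherryParent k p v = u)
  symm := ⟨fun _ _ h => h.symm⟩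
  loopless := ⟨by
    rintro (_ | j | ⟨i, l⟩) h
    · simp at h
    · simp [cherryParent] at h
    · by_cases hl : l = 0
      · simp [cherryParent, hl] at h
      · simp [cherryParent, hl, eq_comm] at h⟩

theorem isRootedBy_cherryStar (k p : ℕ) :
    (cherryStar k p).IsRootedBy none (cherryParent k p) := by
  refine ⟨fun _ _ => Iff.rfl, rfl, fun v => match v with
    | none => 0
    | some (Sum.inl _) => 1
    | some (Sum.inr (_, l)) => if l = 0 then 1 else 2, ?_⟩
  rintro (_ | j | ⟨i, l⟩) h
  · exact absurd rfl h
  · simp [cherryParent]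
  · by_cases hl : l = 0 <;> simp [cherryParent, hl]

/-- The vertices of `cherryStar k p` as those of a star with pendant edges. -/
def cherryStarToPendants {k p : ℕ} {f : Fin (k + 1) → ℕ} (h0 : f 0 = p)
    (h2 : ∀ i : Fin k, f i.succ = 2) :
    Option (Fin p ⊕ Fin k × Fin 3) → Fin (k + 1) ⊕ (Σ v : Fin (k + 1), Fin (f v))
  | none => Sum.inl 0
  | some (Sum.inl j) => Sum.inr ⟨0, ⟨j, by rw [h0]; exact j.2⟩⟩
  | some (Sum.inr (i, l)) =>
    if l = 0 then Sum.inl i.succ else Sum.inr ⟨i.succ, ⟨l - 1, by rw [h2]; omega⟩⟩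

theorem cherryStarToPendants_bijective {k p : ℕ} {f : Fin (k + 1) → ℕ} (h0 : f 0 = p)
    (h2 : ∀ i : Fin k, f i.succ = 2) : Function.Bijective (cherryStarToPendants h0 h2) := by
  constructor
  · rintro (_ | j | ⟨i, l⟩) (_ | j' | ⟨i', l'⟩) h
    · rfl
    · simp [cherryStarToPendants] at h
    · by_cases hl : l' = 0 <;> simp [cherryStarToPendants, hl] at h
      exact absurd h.symm (Fin.succ_ne_zero _)
    · simp [cherryStarToPendants] at h
    · simpa [cherryStarToPendants, Fin.ext_iff] using h
    · by_cases hl : l' = 0 <;> simp [cherryStarToPendants, hl] at h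
      exact absurd h.1.symm (Fin.succ_ne_zero _)
    · by_cases hl : l = 0 <;> simp [cherryStarToPendants, hl] at h
    · by_cases hl : l = 0 <;> simp [cherryStarToPendants, hl] at h
    · by_cases hl : l = 0 <;> by_cases hl' : l' = 0 <;>
        simp only [cherryStarToPendants, hl, hl', if_true, if_false, Sum.inl.injEq,
          Sum.inr.injEq, reduceCtorEq, Sigma.mk.injEq, Fin.succ_inj] at h
      · simp [h, hl, hl']
      · obtain ⟨rfl, h⟩ := h
        have h3 : (l : ℕ) - 1 = l' - 1 := by simpa using h
        have : l = l' := by omega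
        rw [this]
  · rintro (v | ⟨v, j⟩)
    · induction v using Fin.cases with
      | zero => exact ⟨none, rfl⟩
      | succ i => exact ⟨some (Sum.inr (i, 0)), rfl⟩
    · induction v using Fin.cases with
      | zero => exact ⟨some (Sum.inl ⟨j, by rw [← h0]; exact j.2⟩), rfl⟩
      | succ i =>
        have hj : (j : ℕ) < 2 := by rw [← h2 i]; exact j.2
        refine ⟨some (Sum.inr (i, ⟨j + 1, by omega⟩)), ?_⟩
        rw [cherryStarToPendants, if_neg (by simp [Fin.ext_iff])]
        simp

theorem cherryStar_iso_attachPendants {k p : ℕ} {f : Fin (k + 1) → ℕ} (h0 : f 0 = p)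
    (h2 : ∀ i : Fin k, f i.succ = 2) :
    Nonempty (cherryStar k p ≃g (starGraph (0 : Fin (k + 1))).attachPendants f) := by
  refine ⟨⟨Equiv.ofBijective _ (cherryStarToPendants_bijective h0 h2), ?_⟩⟩
  rintro (_ | j | ⟨i, l⟩) (_ | j' | ⟨i', l'⟩)
  · simp
  · simp [cherryStarToPendants, attachPendants, cherryStar, cherryParent]
  · by_cases hl : l' = 0 <;>
      simp [cherryStarToPendants, attachPendants, cherryStar, cherryParent, hl]
    exact (Fin.succ_ne_zero _).symm
  · simp [cherryStarToPendants, attachPendants, cherryStar, cherryParent]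
  · simp [cherryStarToPendants, attachPendants, cherryStar, cherryParent]
  · by_cases hl : l' = 0 <;>
      simp [cherryStarToPendants, attachPendants, cherryStar, cherryParent, hl]
    exact (Fin.succ_ne_zero _).symm
  · by_cases hl : l = 0 <;>
      simp [cherryStarToPendants, attachPendants, cherryStar, cherryParent, hl]
  · by_cases hl : l = 0 <;>
      simp [cherryStarToPendants, attachPendants, cherryStar, cherryParent, hl]
    exact (Fin.succ_ne_zero _).symm
  · by_cases hl : l = 0 <;> by_cases hl' : l' = 0 <;>
      simp [cherryStarToPendants, attachPendants, cherryStar, cherryParent, hl, hl', eq_comm]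

theorem cherryStar_iso_daggerTree (n τ : ℕ) :
    Nonempty (cherryStar (n - τ - 1) (3 * τ + 2 - 2 * n) ≃g daggerTree n τ) :=
  cherryStar_iso_attachPendants (by simp [daggerPendants]) (by simp [daggerPendants])

theorem isTree_daggerTree (n τ : ℕ) : (daggerTree n τ).IsTree := by
  obtain ⟨e⟩ := cherryStar_iso_daggerTree n τ
  exact e.isTree_iff.1 (isRootedBy_cherryStar _ _).isTree

theorem card_daggerVertex {n τ : ℕ} (h1 : τ < n) (h2 : 2 * n ≤ 3 * τ + 2) :
    Fintype.card (DaggerVertex n τ) = n := by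
  obtain ⟨e⟩ := cherryStar_iso_daggerTree n τ
  rw [← Fintype.card_congr e.toEquiv]
  simp
  omega

/-- Each star vertex has at least two pendant neighbours, so a dissociation set misses a vertex of
each of the `n - τ` disjoint blocks. Conversely, the `τ` pendant vertices are independent. The
centre has its two pendants because of `2 * n ≤ 3 * τ`. -/
theorem dissociationNumber_daggerTree {n τ : ℕ} (h1 : τ < n) (h2 : 2 * n ≤ 3 * τ) :
    (daggerTree n τ).dissociationNumber = τ := by
  classical
  have hcard := card_daggerVertex h1 (by omega)
  apply le_antisymm
  · obtain ⟨S, hS, hSc⟩ := (isGreatest_dissociationNumber (daggerTree n τ)).1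
    have hp : ∀ v, 2 ≤ daggerPendants n τ v := by
      intro v
      rw [daggerPendants]
      split_ifs <;> omega
    have hmiss : ∀ v : Fin (n - τ - 1 + 1), ∃ w ∈ Sᶜ, Sum.elim id Sigma.fst w = v := by
      intro v
      by_contra! hno
      have hin : ∀ w : DaggerVertex n τ, Sum.elim id Sigma.fst w = v → w ∈ S := by
        intro w hw
        by_contra hw'
        exact hno w (Finset.mem_compl.2 hw') hw
      have h3 := hS (Sum.inl v) (hin _ rfl) (Sum.inr ⟨v, ⟨0, by have := hp v; omega⟩⟩)
        (hin _ rfl) (Sum.inr ⟨v, ⟨1, by have := hp v; omega⟩⟩) (hin _ rfl) rfl rfl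
      simp at h3
    choose w hw hwv using hmiss
    have hinj : Function.Injective w := fun a b hab => by rw [← hwv a, ← hwv b, hab]
    have h3 := Finset.card_le_card_of_injOn w (s := Finset.univ) (t := Sᶜ)
      (fun a _ => hw a) hinj.injOn
    rw [Finset.card_univ, Fintype.card_fin, Finset.card_compl, hcard] at h3
    omega
  · refine (isGreatest_dissociationNumber (daggerTree n τ)).2
      ⟨Finset.univ.map Function.Embedding.inr, ?_, ?_⟩
    · intro v hv u hu w hw hvu
      rw [Finset.mem_map] at hv hu
      obtain ⟨v, -, rfl⟩ := hv
      obtain ⟨u, -, rfl⟩ := hu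
      exact hvu.elim
    · rw [Finset.card_map, Finset.card_univ]
      rw [Fintype.card_sum, Fintype.card_fin] at hcard
      omega

end CherryStar

end SimpleGraph

/-! ### Comparing a tree with the extremal tree. -/

namespace SimpleGraph

section EdgeForm

variable {α : ℝ}

theorem edgeForm_comm (α a b : ℝ) : edgeForm α a b = edgeForm α b a := by
  simp only [edgeForm]
  ring

theorem edgeForm_le_left (hα₀ : 0 ≤ α) (hα₁ : α < 1) {a a' b : ℝ} (ha : 0 ≤ a) (hb : 0 ≤ b)
    (h : a ≤ a') : edgeForm α a b ≤ edgeForm α a' b := by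
  have h1 : a ^ 2 ≤ a' ^ 2 := pow_le_pow_left₀ ha h 2
  have h2 : a * b ≤ a' * b := mul_le_mul_of_nonneg_right h hb
  have h3 : 0 ≤ 1 - α := by linarith
  simp only [edgeForm]
  gcongr

theorem edgeForm_le_right (hα₀ : 0 ≤ α) (hα₁ : α < 1) {a b b' : ℝ} (ha : 0 ≤ a) (hb : 0 ≤ b)
    (h : b ≤ b') : edgeForm α a b ≤ edgeForm α a b' := by
  rw [edgeForm_comm α a, edgeForm_comm α a]
  exact edgeForm_le_left hα₀ hα₁ hb ha h

theorem edgeForm_lt_left (hα₀ : 0 ≤ α) (hα₁ : α < 1) {a a' b : ℝ} (ha : 0 ≤ a) (hb : 0 < b)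
    (h : a < a') : edgeForm α a b < edgeForm α a' b := by
  have h1 : α * (a ^ 2 + b ^ 2) ≤ α * (a' ^ 2 + b ^ 2) := by
    have := pow_le_pow_left₀ ha h.le 2
    gcongr
  have h2 : 2 * (1 - α) * (a * b) < 2 * (1 - α) * (a' * b) := by
    have := mul_lt_mul_of_pos_right h hb
    have h3 : 0 < 2 * (1 - α) := by linarith
    gcongr
  simp only [edgeForm]
  linarith

end EdgeForm

section Comparison

variable {V : Type*} {k p : ℕ}

/-- The vertices with values `z`, `y₁`, `y₂` and their parents form a path with three vertices,
and `z` has the largest value; it is the top of the path if the top has the largest value, too. -/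
def IsArrangement (par : V → V) (x : V → ℝ) (z y₁ y₂ : V) : Prop :=
  (x y₁ ≤ x z ∧ x y₂ ≤ x z ∧ par y₁ = z ∧ (par y₂ = z ∨ par y₂ = y₁)) ∨
  (x y₁ < x z ∧ x y₂ ≤ x z ∧ par z = y₁ ∧ (par y₂ = y₁ ∨ par y₂ = z)) ∨
  (x y₁ ≤ x z ∧ x y₂ < x z ∧ par y₁ = y₂ ∧ (par z = y₂ ∨ par z = y₁))

/-- The edge leaving the path upwards is moved from its top to `z` and ends at `c`, and the two
edges of the path are made to end at `z`. No contribution is lost, as `z` and `c` carry the largest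
values. If `z` is not the top, the upward edge gains strictly, which settles the case of equality.
-/
theorem IsArrangement.sum_edgeForm_le {α : ℝ} (hα₀ : 0 ≤ α) (hα₁ : α < 1) {par : V → V}
    {x : V → ℝ} (hx : ∀ v, 0 ≤ x v) {c : V} (hc : ∀ v, x v ≤ x c) (hc0 : 0 < x c)
    {z y₁ y₂ : V} (h : IsArrangement par x z y₁ y₂) :
    edgeForm α (x z) (x (par z)) + edgeForm α (x y₁) (x (par y₁)) +
        edgeForm α (x y₂) (x (par y₂)) ≤
      edgeForm α (x z) (x c) + edgeForm α (x y₁) (x z) + edgeForm α (x y₂) (x z) ∧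
    (edgeForm α (x z) (x (par z)) + edgeForm α (x y₁) (x (par y₁)) +
        edgeForm α (x y₂) (x (par y₂)) =
      edgeForm α (x z) (x c) + edgeForm α (x y₁) (x z) + edgeForm α (x y₂) (x z) →
      par y₁ = z ∧ (par y₂ = z ∨ par y₂ = y₁)) := by
  have L : ∀ a a' b, x a ≤ x a' → edgeForm α (x a) (x b) ≤ edgeForm α (x a') (x b) :=
    fun a a' b => edgeForm_le_left hα₀ hα₁ (hx a) (hx b)
  have R : ∀ a b b', x b ≤ x b' → edgeForm α (x a) (x b) ≤ edgeForm α (x a) (x b') :=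
    fun a b b' => edgeForm_le_right hα₀ hα₁ (hx a) (hx b)
  have S : ∀ a a', x a < x a' → edgeForm α (x a) (x (par a)) < edgeForm α (x a') (x c) :=
    fun a a' h => (R a _ _ (hc _)).trans_lt (edgeForm_lt_left hα₀ hα₁ (hx a) hc0 h)
  have C : ∀ a b, edgeForm α (x a) (x b) = edgeForm α (x b) (x a) :=
    fun a b => edgeForm_comm α _ _
  rcases h with ⟨h1, h2, h3, h4⟩ | ⟨h1, h2, h3, h4⟩ | ⟨h1, h2, h3, h4⟩
  · refine ⟨?_, fun _ => ⟨h3, h4⟩⟩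
    have e1 := R z _ _ (hc (par z))
    have e2 : edgeForm α (x y₂) (x (par y₂)) ≤ edgeForm α (x y₂) (x z) := by
      rcases h4 with h4 | h4 <;> rw [h4]
      exact R _ _ _ h1
    rw [h3]
    linarith
  · have e1 := S y₁ z h1
    have e2 : edgeForm α (x y₂) (x (par y₂)) ≤ edgeForm α (x y₂) (x z) := by
      rcases h4 with h4 | h4 <;> rw [h4]
      exact R _ _ _ h1.le
    have e3 : edgeForm α (x z) (x (par z)) = edgeForm α (x y₁) (x z) := by
      rw [h3, C]
    exact ⟨by linarith, fun h => by linarith⟩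
  · have e1 := S y₂ z h2
    have e2 : edgeForm α (x z) (x (par z)) + edgeForm α (x y₁) (x (par y₁)) ≤
        edgeForm α (x y₁) (x z) + edgeForm α (x y₂) (x z) := by
      rcases h4 with h4 | h4 <;> rw [h3, h4]
      · have := R y₁ _ _ h2.le
        rw [C z y₂]
        linarith
      · have := L y₁ z y₂ h1
        rw [C z y₁, C y₂ z]
        linarith
    exact ⟨by linarith, fun h => by linarith⟩

theorem sum_ne_none (inst : DecidablePred fun v : Option (Fin p ⊕ Fin k × Fin 3) => v ≠ none)
    (F : Option (Fin p ⊕ Fin k × Fin 3) → ℝ) :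
    ∑ v ∈ @Finset.filter _ (fun v => v ≠ none) inst Finset.univ, F v = ∑ j, F (some (Sum.inl j)) +
      ∑ i, (F (some (Sum.inr (i, 0))) + F (some (Sum.inr (i, 1))) +
        F (some (Sum.inr (i, 2)))) := by
  rw [Finset.sum_filter, Fintype.sum_option, Fintype.sum_sum_type, Fintype.sum_prod_type]
  simp [Fin.sum_univ_three]

theorem IsRootedBy.alphaForm_le_cherryStar {α : ℝ} (hα₀ : 0 ≤ α) (hα₁ : α < 1)
    {H : SimpleGraph (Option (Fin p ⊕ Fin k × Fin 3))}
    {par : Option (Fin p ⊕ Fin k × Fin 3) → Option (Fin p ⊕ Fin k × Fin 3)}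
    (h : H.IsRootedBy none par) {x : Option (Fin p ⊕ Fin k × Fin 3) → ℝ}
    (hx : ∀ v, 0 ≤ x v) (hc : ∀ v, x v ≤ x none) (hc0 : 0 < x none)
    (harr : ∀ i, IsArrangement par x (some (Sum.inr (i, 0))) (some (Sum.inr (i, 1)))
      (some (Sum.inr (i, 2)))) :
    H.alphaForm α x ≤ (cherryStar k p).alphaForm α x ∧
      (H.alphaForm α x = (cherryStar k p).alphaForm α x →
        ∀ i, par (some (Sum.inr (i, 1))) = some (Sum.inr (i, 0)) ∧
          (par (some (Sum.inr (i, 2))) = some (Sum.inr (i, 0)) ∨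
            par (some (Sum.inr (i, 2))) = some (Sum.inr (i, 1)))) := by
  classical
  rw [h.alphaForm_eq, (isRootedBy_cherryStar k p).alphaForm_eq, sum_ne_none, sum_ne_none]
  simp only [cherryParent_branch_zero, cherryParent_branch_of_ne _ (show (1 : Fin 3) ≠ 0 by decide),
    cherryParent_branch_of_ne _ (show (2 : Fin 3) ≠ 0 by decide)]
  have h1 := Finset.sum_le_sum fun j (_ : j ∈ (Finset.univ : Finset (Fin p))) =>
    edgeForm_le_right hα₀ hα₁ (hx (some (Sum.inl j))) (hx (par (some (Sum.inl j)))) (hc _)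
  have h2 := fun i => (harr i).sum_edgeForm_le hα₀ hα₁ hx hc hc0
  have h3 := Finset.sum_le_sum fun i (_ : i ∈ (Finset.univ : Finset (Fin k))) => (h2 i).1
  refine ⟨add_le_add h1 h3, fun heq i => (h2 i).2 ?_⟩
  have h4 := le_antisymm h3 (by
    by_contra hlt
    exact absurd heq (ne_of_lt (add_lt_add_of_le_of_lt h1 (not_le.1 hlt))))
  exact (Finset.sum_eq_sum_iff_of_le fun i _ => (h2 i).1).1 h4 i (Finset.mem_univ i)

/-- An injective family on the root and the branches extends to the vertices of `cherryStar k p`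
if the numbers of vertices agree. -/
theorem exists_equiv_of_injective [Fintype V] (hcard : Fintype.card V = 1 + 3 * k + p)
    {g : Option (Fin k × Fin 3) → V} (hg : Function.Injective g) :
    ∃ e : Option (Fin p ⊕ Fin k × Fin 3) ≃ V, e none = g none ∧
      ∀ a, e (some (Sum.inr a)) = g (some a) := by
  classical
  have h1 : ((Finset.univ.image g)ᶜ).card = p := by
    rw [Finset.card_compl, Finset.card_image_of_injective _ hg,
      Finset.card_univ, hcard]
    simp
    omega
  let r := (Finset.equivFinOfCardEq h1).symm
  have hr : ∀ j a, (r j : V) ≠ g a := by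
    intro j a hja
    have := (r j).2
    rw [Finset.mem_compl] at this
    exact this (Finset.mem_image.2 ⟨a, Finset.mem_univ a, hja.symm⟩)
  let F : Option (Fin p ⊕ Fin k × Fin 3) → V
    | none => g none
    | some (Sum.inl j) => r j
    | some (Sum.inr a) => g (some a)
  have hF : Function.Injective F := by
    rintro (_ | j | a) (_ | j' | a') h
    · rfl
    · exact absurd h.symm (hr _ _)
    · exact absurd (hg h) (by simp)
    · exact absurd h (hr _ _)
    · rw [r.injective (Subtype.ext h)]
    · exact absurd h (hr _ _)
    · exact absurd (hg h) (by simp)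
    · exact absurd h.symm (hr _ _)
    · simpa using hg h
  have hbij : Function.Bijective F := by
    rw [Fintype.bijective_iff_injective_and_card]
    refine ⟨hF, ?_⟩
    rw [hcard]
    simp
    omega
  exact ⟨Equiv.ofBijective F hbij, rfl, fun a => rfl⟩

theorem IsRootedBy.exists_isArrangement {G : SimpleGraph V} {c : V} {par : V → V}
    (h : G.IsRootedBy c par) (x : V → ℝ) {q : V × V × V} (hq : IsRootedPath c par q) :
    ∃ a : Fin 3 → V, Function.Injective a ∧ (∀ l, a l ∈ tripleSupport q) ∧
      IsArrangement par x (a 0) (a 1) (a 2) := by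
  obtain ⟨t, m, b⟩ := q
  have h1 : t ≠ m := h.top_ne_mid hq
  have h2 : t ≠ b := h.top_ne_bot hq
  have h3 : b ≠ m := hq.bot_ne_mid
  have h4 : par m = t := hq.par_mid
  have h5 : par b = t ∨ par b = m := hq.par_bot
  have inj : ∀ u v w : V, u ≠ v → u ≠ w → v ≠ w → Function.Injective ![u, v, w] := by
    intro u v w huv huw hvw i j hij
    fin_cases i <;> fin_cases j <;> simp_all
  have mem : ∀ u v w : V, u ∈ tripleSupport (t, m, b) → v ∈ tripleSupport (t, m, b) →
      w ∈ tripleSupport (t, m, b) → ∀ l, ![u, v, w] l ∈ tripleSupport (t, m, b) := by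
    intro u v w hu hv hw l
    fin_cases l <;> assumption
  have ht : t ∈ tripleSupport (t, m, b) := mem_tripleSupport.2 (by tauto)
  have hm : m ∈ tripleSupport (t, m, b) := mem_tripleSupport.2 (by tauto)
  have hb : b ∈ tripleSupport (t, m, b) := mem_tripleSupport.2 (by tauto)
  -- Ties are resolved in favour of the top, so in the other two cases the top is strictly smaller.
  by_cases hmt : x m ≤ x t ∧ x b ≤ x t
  · exact ⟨![t, m, b], inj _ _ _ h1 h2 h3.symm, mem _ _ _ ht hm hb,
      Or.inl ⟨hmt.1, hmt.2, h4, h5⟩⟩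
  · rcases le_total (x b) (x m) with hbm | hbm
    · refine ⟨![m, t, b], inj _ _ _ h1.symm h3.symm h2, mem _ _ _ hm ht hb,
        Or.inr (Or.inl ⟨?_, hbm, h4, h5⟩)⟩
      by_contra hlt
      exact hmt ⟨not_lt.1 hlt, hbm.trans (not_lt.1 hlt)⟩
    · refine ⟨![b, m, t], inj _ _ _ h3 h2.symm h1.symm, mem _ _ _ hb hm ht,
        Or.inr (Or.inr ⟨hbm, ?_, h4, h5⟩)⟩
      by_contra hlt
      exact hmt ⟨hbm.trans (not_lt.1 hlt), not_lt.1 hlt⟩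

/-- If a tree acts on a positive vector as `cherryStar k p` does, and its branches contain paths
with three vertices that start at the vertices `some (Sum.inr (i, 0))`, it is that tree. -/
theorem IsRootedBy.eq_cherryStar {α : ℝ} (hα₀ : 0 ≤ α) (hα₁ : α < 1)
    {H : SimpleGraph (Option (Fin p ⊕ Fin k × Fin 3))}
    {par : Option (Fin p ⊕ Fin k × Fin 3) → Option (Fin p ⊕ Fin k × Fin 3)}
    (h : H.IsRootedBy none par) {x : Option (Fin p ⊕ Fin k × Fin 3) → ℝ}
    (hx : ∀ v, 0 < x v)
    (heq : (H.alphaMatrix α).mulVec x = ((cherryStar k p).alphaMatrix α).mulVec x)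
    (hpath : ∀ i, par (some (Sum.inr (i, 1))) = some (Sum.inr (i, 0)) ∧
          (par (some (Sum.inr (i, 2))) = some (Sum.inr (i, 0)) ∨
            par (some (Sum.inr (i, 2))) = some (Sum.inr (i, 1)))) :
    H = cherryStar k p := by
  have h' := isRootedBy_cherryStar k p
  have h10 : (1 : Fin 3) ≠ 0 := by decide
  have h20 : (2 : Fin 3) ≠ 0 := by decide
  have hl : ∀ l : Fin 3, l = 0 ∨ l = 1 ∨ l = 2 := by decide
  -- By `hpath` the children of the root in `H` are among those in `cherryStar k p`. The equal
  -- matrix actions at the root then make the two sets of children equal.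
  have hroot : ∀ u, u ≠ none → cherryParent k p u = none → par u = none := by
    refine h.par_eq_of_mulVec_eq h' hα₀ hα₁ hx (congrFun heq none) (fun hn => absurd rfl hn) ?_
    rintro (_ | j | ⟨i, l⟩) hu hpu
    · rfl
    · rfl
    · rcases hl l with rfl | rfl | rfl
      · rfl
      · rw [(hpath i).1] at hpu
        exact absurd hpu (by simp)
      · rcases (hpath i).2 with h2 | h2 <;> rw [h2] at hpu <;> exact absurd hpu (by simp)
  -- The same comparison at a branch vertex, whose parent is now known, excludes the alternative
  -- that vertex `2` hangs from vertex `1`.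
  have hbranch : ∀ i u, u ≠ none → cherryParent k p u = some (Sum.inr (i, 0)) →
      par u = some (Sum.inr (i, 0)) := by
    intro i
    refine h.par_eq_of_mulVec_eq h' hα₀ hα₁ hx (congrFun heq _)
      (fun hn => hroot _ hn rfl) ?_
    rintro (_ | j | ⟨i', l⟩) hu hpu
    · exact absurd rfl hu
    · rw [hroot _ hu rfl] at hpu
      exact absurd hpu (by simp)
    · rcases hl l with rfl | rfl | rfl
      · rw [hroot _ hu rfl] at hpu
        exact absurd hpu (by simp)
      · rw [cherryParent_branch_of_ne _ h10, ← hpu, (hpath i').1]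
      · rw [cherryParent_branch_of_ne _ h20]
        rcases (hpath i').2 with h2 | h2 <;> rw [h2] at hpu
        · exact hpu
        · simp at hpu
  refine h.eq_of_par_eq h' ?_
  rintro (_ | j | ⟨i, l⟩) hu
  · exact absurd rfl hu
  · exact hroot _ hu rfl
  · by_cases h0 : l = 0
    · subst h0
      exact hroot _ hu rfl
    · rw [cherryParent_branch_of_ne _ h0]
      exact hbranch i _ hu (cherryParent_branch_of_ne _ h0)

theorem IsTree.alphaIndex_le_cherryStar [Fintype V] {G : SimpleGraph V} (hG : G.IsTree)
    (hcard : Fintype.card V = 1 + 3 * k + p)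
    (hk : k + 1 + G.dissociationNumber ≤ Fintype.card V) {α : ℝ} (hα₀ : 0 ≤ α) (hα₁ : α < 1) :
    G.alphaIndex α ≤ (cherryStar k p).alphaIndex α ∧
      (G.alphaIndex α = (cherryStar k p).alphaIndex α → Nonempty (G ≃g cherryStar k p)) := by
  have : Nonempty V := hG.connected.nonempty
  obtain ⟨x, hx0, hxne, hx⟩ := exists_nonneg_eigenvector hα₀ hα₁.le G
  have hpos := hG.connected.pos_of_mulVec_eq hα₁ hx0 hxne hx
  obtain ⟨c, hc⟩ := Finite.exists_max x
  obtain ⟨par, h⟩ := hG.exists_isRootedBy c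
  obtain ⟨q, hq, hqc, hqd⟩ := h.exists_triples_avoiding_root hk
  choose a ha has harr using fun i => h.exists_isArrangement x (hq i)
  have hac : ∀ i l, a i l ≠ c := by
    intro i l hal
    have := has i l
    rw [hal, mem_tripleSupport] at this
    rcases this with h1 | h1 | h1
    · exact hqc i h1.symm
    · exact (hq i).mid_ne h1.symm
    · exact (hq i).bot_ne h1.symm
  let g : Option (Fin k × Fin 3) → V
    | none => c
    | some (i, l) => a i l
  have hg : Function.Injective g := by
    rintro (_ | ⟨i, l⟩) (_ | ⟨i', l'⟩) hgg
    · rfl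
    · exact absurd hgg.symm (hac _ _)
    · exact absurd hgg (hac _ _)
    · have hgg : a i l = a i' l' := hgg
      by_cases hi : i = i'
      · subst hi
        rw [ha i hgg]
      · exact absurd (hgg ▸ has i l) (Finset.disjoint_right.1 (hqd hi) (has i' l'))
  obtain ⟨e, hen, heb⟩ := exists_equiv_of_injective hcard hg
  have hec : e.symm c = none := by rw [Equiv.symm_apply_eq, hen]
  have hH := h.comap e
  rw [hec] at hH
  have harr' : ∀ i, IsArrangement (fun w => e.symm (par (e w))) (x ∘ e)
      (some (Sum.inr (i, 0))) (some (Sum.inr (i, 1))) (some (Sum.inr (i, 2))) := by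
    intro i
    have := harr i
    simpa only [IsArrangement, Function.comp_apply, Equiv.symm_apply_eq, heb] using this
  have hcn : x (e none) = x c := by rw [hen]
  obtain ⟨hle, heq⟩ := hH.alphaForm_le_cherryStar hα₀ hα₁ (x := x ∘ e) (fun v => hx0 _)
    (fun v => by simpa only [Function.comp_apply, hcn] using hc _) (hpos _) harr'
  let E : G.comap e ≃g G := Iso.comap e G
  have hform : (G.comap e).alphaForm α (x ∘ e) = G.alphaForm α x := alphaForm_comp_iso α E x
  have hform' : (G.comap e).alphaForm α (x ∘ e) = G.alphaIndex α * ((x ∘ e) ⬝ᵥ (x ∘ e)) := by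
    rw [hform, alphaForm, hx, dotProduct_smul, smul_eq_mul]
    congr 1
    exact (e.sum_comp fun v => x v * x v).symm
  have hdot : 0 < (x ∘ e) ⬝ᵥ (x ∘ e) :=
    Finset.sum_pos (fun v _ => mul_pos (hpos _) (hpos _)) ⟨none, Finset.mem_univ _⟩
  have hle' := alphaForm_le α (cherryStar k p) (x ∘ e)
  constructor
  · exact le_of_mul_le_mul_right (by linarith) hdot
  · intro hind
    have h1 : (G.comap e).alphaForm α (x ∘ e) = (cherryStar k p).alphaForm α (x ∘ e) :=
      le_antisymm hle (by rw [hform', hind]; exact hle')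
    -- With equal indices the vector attains the Rayleigh bound for both trees, hence is an
    -- eigenvector of both for the same eigenvalue.
    have h2 := mulVec_eq_of_alphaForm_eq (G := cherryStar k p) (x := x ∘ e)
      (by rw [← h1, hform', hind])
    have h3 := mulVec_eq_of_alphaForm_eq (G := G.comap e) (x := x ∘ e)
      (by rw [hform', E.alphaIndex_eq])
    have h4 := hH.eq_cherryStar hα₀ hα₁ (x := x ∘ e) (fun v => hpos _)
      (by rw [h2, h3, E.alphaIndex_eq, hind]) (heq h1)
    exact ⟨h4 ▸ E.symm⟩

end Comparison

end SimpleGraph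

/-! ### The quartic and its largest zero. -/

theorem alphaQuartic_eq (α k p x : ℝ) :
    alphaQuartic α (1 + 3 * k + p) (2 * k + p) x =
      ((x - 3 * α) * (x - α) - 2 * (1 - α) ^ 2) *
          ((x - (k + p) * α) * (x - α) - p * (1 - α) ^ 2) -
        k * (1 - α) ^ 2 * (x - α) ^ 2 := by
  simp only [alphaQuartic]
  ring

/-- For `x > α` the function `((x - d α) (x - α) - m (1 - α) ^ 2) / (x - α)` increases. -/
theorem quadratic_mul_lt {α d m l x : ℝ} (hm : 0 ≤ m) (hl : α < l) (hx : l < x) :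
    ((l - d * α) * (l - α) - m * (1 - α) ^ 2) * (x - α) <
      ((x - d * α) * (x - α) - m * (1 - α) ^ 2) * (l - α) := by
  have h1 : 0 < (x - l) * ((l - α) * (x - α) + m * (1 - α) ^ 2) := by
    have h2 : 0 < (l - α) * (x - α) := mul_pos (by linarith) (by linarith)
    have h3 : 0 ≤ m * (1 - α) ^ 2 := by positivity
    exact mul_pos (by linarith) (by linarith)
  linear_combination h1

/-- Divide both quadratic factors by `x - α`. At `l` the quotients are positive with product `k (1 -
α) ^ 2`, and both increase, so beyond `l` the product is larger. -/
theorem alphaQuartic_pos_of_branch {α k p l x : ℝ} (hp : 0 ≤ p) (hk : 0 < k) (hα₁ : α < 1)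
    (hl : α < l) (hQ : 0 < (l - 3 * α) * (l - α) - 2 * (1 - α) ^ 2)
    (hroot : alphaQuartic α (1 + 3 * k + p) (2 * k + p) l = 0) (hx : l < x) :
    0 < alphaQuartic α (1 + 3 * k + p) (2 * k + p) x := by
  rw [alphaQuartic_eq] at hroot ⊢
  have h1 := quadratic_mul_lt (d := 3) (m := 2) (by norm_num) hl hx
  have h2 := quadratic_mul_lt (d := k + p) (m := p) hp hl hx
  have ha : 0 < l - α := by linarith
  have hs : 0 < x - α := by linarith
  have hβ : 0 < (1 - α) ^ 2 := pow_pos (by linarith) 2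
  set Q := (l - 3 * α) * (l - α) - 2 * (1 - α) ^ 2
  set R := (l - (k + p) * α) * (l - α) - p * (1 - α) ^ 2
  set Q' := (x - 3 * α) * (x - α) - 2 * (1 - α) ^ 2
  set R' := (x - (k + p) * α) * (x - α) - p * (1 - α) ^ 2
  have hR : 0 < R := by
    have : 0 < Q * R := by
      have : 0 < k * (1 - α) ^ 2 * (l - α) ^ 2 := by positivity
      linarith
    exact pos_of_mul_pos_right this hQ.le
  have h3 : (Q * (x - α)) * (R * (x - α)) < (Q' * (l - α)) * (R' * (l - α)) :=
    mul_lt_mul'' h1 h2 (by positivity) (by positivity)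
  have h4 : 0 < (Q' * R' - k * (1 - α) ^ 2 * (x - α) ^ 2) * (l - α) ^ 2 := by
    have h5 : Q * R = k * (1 - α) ^ 2 * (l - α) ^ 2 := by linarith
    have h6 : (Q * (x - α)) * (R * (x - α)) =
        k * (1 - α) ^ 2 * (l - α) ^ 2 * (x - α) ^ 2 := by rw [← h5]; ring
    rw [h6] at h3
    linarith
  exact pos_of_mul_pos_left h4 (by positivity)

/-- For `k = 0` the quartic is the product of the two quadratics. The star only controls the second,
so the sign of the first has to be supplied. -/
theorem alphaQuartic_pos_of_star {α p l x : ℝ} (hp : 0 ≤ p)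
    (hl : α < l) (hR : (l - p * α) * (l - α) - p * (1 - α) ^ 2 = 0) (hx : l < x)
    (hQ : 0 < (x - p * α) * (x - α) - p * (1 - α) ^ 2 →
      0 < (x - 3 * α) * (x - α) - 2 * (1 - α) ^ 2) :
    0 < alphaQuartic α (1 + 3 * 0 + p) (2 * 0 + p) x := by
  have h2 := quadratic_mul_lt (d := p) (m := p) hp hl hx
  rw [hR, zero_mul] at h2
  have h3 := pos_of_mul_pos_left h2 (by linarith)
  rw [alphaQuartic_eq]
  have := mul_pos (hQ h3) h3
  simpa using this

namespace SimpleGraph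

/-- The eigenvalue equation of `A_α` for `cherryStar k p` in coordinates. -/
theorem cherryStar_mulVec_eq {k p : ℕ} {α μ : ℝ} {x : Option (Fin p ⊕ Fin k × Fin 3) → ℝ}
    (h : ((cherryStar k p).alphaMatrix α).mulVec x = μ • x) :
    (μ - (k + p) * α) * x none =
        (1 - α) * (∑ j, x (some (Sum.inl j)) + ∑ i, x (some (Sum.inr (i, 0)))) ∧
      (∀ j, (μ - α) * x (some (Sum.inl j)) = (1 - α) * x none) ∧
      ∀ i, ((μ - 3 * α) * (μ - α) - 2 * (1 - α) ^ 2) * x (some (Sum.inr (i, 0))) =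
        (1 - α) * (μ - α) * x none := by
  classical
  have h' := isRootedBy_cherryStar k p
  have key : ∀ v, (if v ≠ none then α * x v + (1 - α) * x (cherryParent k p v) else 0) +
      (∑ j : Fin p, (if none = v then α * x v + (1 - α) * x (some (Sum.inl j)) else 0) +
        ∑ i : Fin k, ((if none = v then α * x v + (1 - α) * x (some (Sum.inr (i, 0))) else 0) +
          (if some (Sum.inr (i, 0)) = v then
            α * x v + (1 - α) * x (some (Sum.inr (i, 1))) else 0) +
          (if some (Sum.inr (i, 0)) = v then
            α * x v + (1 - α) * x (some (Sum.inr (i, 2))) else 0))) = μ * x v := by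
    intro v
    have := congrFun h v
    rw [h'.mulVec_apply, ← Finset.filter_filter, Finset.sum_filter, sum_ne_none] at this
    convert this <;> rfl
  refine ⟨?_, fun j => ?_, fun i => ?_⟩
  · have := key none
    simp only [ne_eq, not_true_eq_false, if_false, if_true, reduceCtorEq, add_zero, zero_add,
      Finset.sum_add_distrib, Finset.sum_const, Finset.card_univ, Fintype.card_fin,
      nsmul_eq_mul, ← Finset.mul_sum] at this
    linear_combination -this
  · have := key (some (Sum.inl j))
    simp [cherryParent] at this
    linear_combination -this
  · have h0 := key (some (Sum.inr (i, 0)))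
    have h1 := key (some (Sum.inr (i, 1)))
    have h2 := key (some (Sum.inr (i, 2)))
    simp [cherryParent, Finset.sum_add_distrib] at h0 h1 h2
    -- The factor `μ - α` allows both leaf entries to be eliminated without a division.
    linear_combination -(μ - α) * h0 - (1 - α) * (h1 + h2)

/-- The index is always a zero. It fails to be the largest one for `k = 0`, `p = 2` and `α > 0`,
where the first quadratic factor is negative at the index and has a larger zero. -/
theorem exists_isGreatest_alphaQuartic {α : ℝ} (hα₀ : 0 ≤ α) (hα₁ : α < 1) {k p : ℕ}
    (hp : 2 ≤ p) :
    ∃ θ : ℝ, IsGreatest {x : ℝ | alphaQuartic α (1 + 3 * k + p) (2 * k + p) x = 0} θ ∧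
      (cherryStar k p).alphaIndex α ≤ θ ∧
      (4 ≤ 1 + 3 * k + p ∨ α = 0 → (cherryStar k p).alphaIndex α = θ) := by
  obtain ⟨x, hx0, hxne, hx⟩ := exists_nonneg_eigenvector hα₀ hα₁.le (cherryStar k p)
  have hpos := (isRootedBy_cherryStar k p).isTree.connected.pos_of_mulVec_eq hα₁ hx0 hxne hx
  set l := (cherryStar k p).alphaIndex α
  obtain ⟨hroot, hleaf, hbranch⟩ := cherryStar_mulVec_eq hx
  have hβ : 0 < 1 - α := by linarith
  have hc := hpos none
  have hp' : (2 : ℝ) ≤ p := by exact_mod_cast hp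
  have hl : α < l := by
    have h1 := hleaf ⟨0, by omega⟩
    have h2 : 0 < (l - α) * x (some (Sum.inl ⟨0, by omega⟩)) := by
      rw [h1]
      positivity
    linarith [pos_of_mul_pos_left h2 (hx0 _)]
  have hsum : (l - α) * ∑ j, x (some (Sum.inl j)) = p * ((1 - α) * x none) := by
    rw [Finset.mul_sum, Finset.sum_congr rfl fun j _ => hleaf j]
    simp
  have hsum' : ((l - 3 * α) * (l - α) - 2 * (1 - α) ^ 2) * ∑ i, x (some (Sum.inr (i, 0))) =
      k * ((1 - α) * (l - α) * x none) := by
    rw [Finset.mul_sum, Finset.sum_congr rfl fun i _ => hbranch i]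
    simp
  have hzero : alphaQuartic α (1 + 3 * k + p) (2 * k + p) l = 0 := by
    rw [alphaQuartic_eq]
    refine (mul_eq_zero.1 ?_).resolve_right hc.ne'
    linear_combination (l - α) * ((l - 3 * α) * (l - α) - 2 * (1 - α) ^ 2) * hroot +
      (1 - α) * ((l - 3 * α) * (l - α) - 2 * (1 - α) ^ 2) * hsum + (1 - α) * (l - α) * hsum'
  -- The third alternative serves to bound the zeros in every case: for `y > 5` the first factor is
  -- positive, since `(y - 3 * α) * (y - α) > 8`.
  have hmain : ∀ y, l < y → (4 ≤ 1 + 3 * k + p ∨ α = 0 ∨ 5 < y) →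
      0 < alphaQuartic α (1 + 3 * k + p) (2 * k + p) y := by
    intro y hy hcase
    rcases Nat.eq_zero_or_pos k with rfl | hk
    · simp only [Nat.cast_zero]
      have hR : (l - p * α) * (l - α) - p * (1 - α) ^ 2 = 0 := by
        refine (mul_eq_zero.1 ?_).resolve_right hc.ne'
        simp only [Nat.cast_zero, Finset.univ_eq_empty, Finset.sum_empty] at hroot
        linear_combination (l - α) * hroot + (1 - α) * hsum
      refine alphaQuartic_pos_of_star (by positivity) hl hR hy fun hRy => ?_
      rcases hcase with h4 | rfl | h5
      · have hp3 : (3 : ℝ) ≤ p := by exact_mod_cast (by omega : 3 ≤ p)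
        -- The first factor minus the second is `(p - 3) α (y - α) + (p - 2) (1 - α) ^ 2`.
        have h1 : 0 ≤ (p - 3) * (α * (y - α)) :=
          mul_nonneg (by linarith) (mul_nonneg hα₀ (by linarith))
        have h2 : 0 ≤ (p - 2) * (1 - α) ^ 2 := mul_nonneg (by linarith) (by positivity)
        linarith
      · linarith
      · nlinarith
    · have hQ : 0 < (l - 3 * α) * (l - α) - 2 * (1 - α) ^ 2 := by
        have h1 := hbranch ⟨0, hk⟩
        have h2 : 0 < (1 - α) * (l - α) * x none :=
          mul_pos (mul_pos hβ (by linarith)) hc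
        rw [← h1] at h2
        exact pos_of_mul_pos_left h2 (hx0 _)
      exact alphaQuartic_pos_of_branch (by positivity) (by exact_mod_cast hk) hα₁ hl hQ hzero hy
  have hbdd : BddAbove {x : ℝ | alphaQuartic α (1 + 3 * k + p) (2 * k + p) x = 0} := by
    refine ⟨max l 5, fun y hy => ?_⟩
    by_contra! hlt
    rw [max_lt_iff] at hlt
    exact (hmain y hlt.1 (Or.inr (Or.inr hlt.2))).ne' hy
  have hclosed : IsClosed {x : ℝ | alphaQuartic α (1 + 3 * k + p) (2 * k + p) x = 0} :=
    isClosed_eq (by unfold alphaQuartic; fun_prop) continuous_const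
  refine ⟨_, ⟨hclosed.csSup_mem ⟨l, hzero⟩ hbdd, fun y hy => le_csSup hbdd hy⟩,
    le_csSup hbdd hzero, fun hcase => le_antisymm (le_csSup hbdd hzero)
      (csSup_le ⟨l, hzero⟩ fun y hy => ?_)⟩
  by_contra! hlt
  exact (hmain y hlt (hcase.imp_right Or.inl)).ne' hy

end SimpleGraph

theorem theorem1p3 {V : Type*} [Fintype V] (T : SimpleGraph V) (hT : T.IsTree)
    (n τ : ℕ) (hn : 3 ≤ n) (hcard : Fintype.card V = n) (hτ : T.dissociationNumber = τ)
    (α : ℝ) (hα₀ : 0 ≤ α) (hα₁ : α < 1) :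
    -- the bound by the largest zero `θ` of the quartic, and the case of equality
    (∃ θ : ℝ, IsGreatest {x : ℝ | alphaQuartic α n τ x = 0} θ ∧
      T.alphaIndex α ≤ θ ∧
      ((4 ≤ n ∨ α = 0) →
        (T.alphaIndex α = θ ↔ Nonempty (T ≃g SimpleGraph.daggerTree n τ)))) ∧
    -- `S†_{n,τ}` is a tree of order `n` with dissociation number `τ`
    ((SimpleGraph.daggerTree n τ).IsTree ∧
      Fintype.card (SimpleGraph.DaggerVertex n τ) = n ∧
      (SimpleGraph.daggerTree n τ).dissociationNumber = τ) ∧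
    -- and, up to isomorphism, it is the only one of them with the largest index
    (T.alphaIndex α ≤ (SimpleGraph.daggerTree n τ).alphaIndex α ∧
      (T.alphaIndex α = (SimpleGraph.daggerTree n τ).alphaIndex α ↔
        Nonempty (T ≃g SimpleGraph.daggerTree n τ))) := by
  have hlt : τ < n := by
    have := hT.dissociationNumber_lt_card (by omega)
    omega
  have hle : 2 * n ≤ 3 * τ := by
    obtain ⟨c⟩ := hT.connected.nonempty
    obtain ⟨par, h⟩ := hT.exists_isRootedBy c
    have := h.three_mul_le
    omega
  obtain ⟨e⟩ := SimpleGraph.cherryStar_iso_daggerTree n τ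
  have hindex := e.alphaIndex_eq α
  -- No subtraction truncates, by `hlt` and `hle`, so `1 + 3k + p = n` and `2k + p = τ`.
  obtain ⟨hbound, heq⟩ := hT.alphaIndex_le_cherryStar (k := n - τ - 1) (p := 3 * τ + 2 - 2 * n)
    (by omega) (by omega) hα₀ hα₁
  rw [hindex] at hbound heq
  have hiff : T.alphaIndex α = (SimpleGraph.daggerTree n τ).alphaIndex α ↔
      Nonempty (T ≃g SimpleGraph.daggerTree n τ) :=
    ⟨fun h => (heq h).map fun f => f.trans e, fun ⟨f⟩ => f.alphaIndex_eq α⟩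
  refine ⟨?_, ⟨SimpleGraph.isTree_daggerTree n τ, SimpleGraph.card_daggerVertex hlt (by omega),
    SimpleGraph.dissociationNumber_daggerTree hlt hle⟩, hbound, hiff⟩
  obtain ⟨θ, hθ, hθle, hθeq⟩ := SimpleGraph.exists_isGreatest_alphaQuartic hα₀ hα₁
    (k := n - τ - 1) (p := 3 * τ + 2 - 2 * n) (by omega)
  have hn' : (1 : ℝ) + 3 * (n - τ - 1 : ℕ) + (3 * τ + 2 - 2 * n : ℕ) = n := by
    exact_mod_cast (by omega : 1 + 3 * (n - τ - 1) + (3 * τ + 2 - 2 * n) = n)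
  have hτ' : (2 : ℝ) * (n - τ - 1 : ℕ) + (3 * τ + 2 - 2 * n : ℕ) = τ := by
    exact_mod_cast (by omega : 2 * (n - τ - 1) + (3 * τ + 2 - 2 * n) = τ)
  rw [hn', hτ'] at hθ
  rw [hindex] at hθle hθeq
  refine ⟨θ, hθ, hbound.trans hθle, fun hcase => ?_⟩
  rw [← hθeq (hcase.imp_left fun h => by omega)]
  exact hiff
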